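/- **Setting.** A *diptych* $\mathsf D=(\mathcal D;\mathcal D_i,\mathcal D_s)$ is a category $\mathcal D$ with finite non-void products and two subcategories, $\mathcal D_i$ (good monos) and $\mathcal D_s$ (good epis), such that: $\mathcal D_i\cap\mathcal D_s$ is the class of all isomorphisms; both are stable under products; arrows of $\mathcal D_i$ are monos and arrows of $\mathcal D_s$ are epis; $gf\in\mathcal D_i$ implies $f\in\mathcal D_i$; $gf\in\mathcal D_s$ and $f\in\mathcal D_s$ imply $g\in\mathcal D_s$; for $s\colon A\to B$ in $\mathcal D_s$ and $i\colon B'\to B$ in $\mathcal D_i$ there is a pullback $i'\colon A'\to A$, $s'\colon A'\to B'$ with $i'\in\mathcal D_i$, $s'\in\mathcal D_s$; conversely, in a pullback square of this shape with $i'\in\mathcal D_i$ and $s,s'\in\mathcal D_s$ one has $i\in\mathcal D_i$; pullback squares with all four arrows in $\mathcal D_s$ are pushouts. An object $B$ is *s-basic* if the projection $B\times B\to B$ is in $\mathcal D_s$. A *$\mathsf D$-groupoid* $\mathbf G$ is an internal groupoid in $\mathcal D$ with base $G_0$ and object of arrows $G_1$ whose source map $\alpha_{\mathbf G}\colon G_1\to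 G_0$ is in $\mathcal D_s$ ($\beta_{\mathbf G}$ is the target map); its *transitor* is $\tau_{\mathbf G}=(\beta_{\mathbf G},\alpha_{\mathbf G})\colon G_1\to G_0\times G_0$. Morphisms are internal functors $\mathbf f=(f_0,f_1)$. $\mathbf G$ is *principal* if there is $q\colon G_0\to Q$ in $\mathcal D_s$ such that $(\beta_{\mathbf G},\alpha_{\mathbf G})$ is the kernel pair of $q$. $\mathsf D$ is a *Godement diptych* if every $\mathsf D$-groupoid with $\tau\in\mathcal D_i$ is principal. A commutative square with top $u\colon A'\to A$, left $f'\colon A'\to B'$, right $f\colon A\to B$, bottom $v\colon B'\to B$ is *ipb* if $(f',u)\colon A'\to B'\times A$ is in $\mathcal D_i$; *gpb* if it is ipb and a pullback; *spb* if $(v,f)$ has a gpb pullback $P$ and the canonical arrow $A'\to P$ is in $\mathcal D_s$. For $\mathbf f\colon\mathbf H\to\mathbf G$ let $\mathbf a(\mathbf f)$ be the square with vertical arrows $\alpha_{\mathbf H},\alpha_{\mathbf G}$ and horizontal arrows $f_1,f_0$, and let $\mathbf t(\mathbf f)$ be the square with vertical arrows $\tau_{\mathbf H},\tau_{\mathbf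 G}$ and horizontal arrows $f_1,f_0\times f_0$. Then $\mathbf f$ is an *actor* / *hypo-actor* / *hyper-actor* if $\mathbf a(\mathbf f)$ is gpb / ipb / spb, and it is *i-faithful* / an *inductor* if $\mathbf t(\mathbf f)$ is ipb / gpb. It is a *$\mathsf D$-equivalence* if it is an inductor and the arrow $H_0\times_{G_0}G_1\to G_0$ induced by $\beta_{\mathbf G}$ (fibred product of $f_0$ and $\alpha_{\mathbf G}$) is in $\mathcal D_s$; an *i-equivalence* if it is a $\mathsf D$-equivalence with $f_1\in\mathcal D_i$; an *s-equivalence* if it is an inductor with $f_0\in\mathcal D_s$. An *activation* of $\mathbf f\colon\mathbf H\to\mathbf G$ is a factorization $\mathbf f=\mathbf f_1\circ\mathbf h_1$ through a $\mathsf D$-groupoid $\mathbf H_1$ with s-basic base in which $\mathbf f_1\colon\mathbf H_1\to\mathbf G$ is an actor. An activation $\mathbf f=\widehat{\mathbf f}\circ\widehat{\mathbf h}$ through $\widehat{\mathbf H}$ is *universal* if for every activation $\mathbf f=\mathbf f'\circ\mathbf h'$ through $\mathbf H'$ there is a unique morphism $\mathbf k\colon\widehat{\mathbf H}\to\mathbf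 H'$ with $\mathbf k\circ\widehat{\mathbf h}=\mathbf h'$ and $\mathbf f'\circ\mathbf k=\widehat{\mathbf f}$. **Theorem.** Let $\mathsf D$ be a Godement diptych and let $\mathbf f\colon\mathbf H\to\mathbf G$ be an i-faithful morphism of $\mathsf D$-groupoids with s-basic bases. Then: 1. $\mathbf f$ admits a universal activation $\mathbf f=\widehat{\mathbf f}\circ\widehat{\mathbf h}$; any two universal activations are related by a unique isomorphism compatible with the two factorizations; and $\widehat{\mathbf h}$ is a $\mathsf D$-equivalence. 2. $\mathbf f$ is a hypo-actor if and only if $\widehat{\mathbf h}$ is an i-equivalence. 3. $\mathbf f$ is a hyper-actor if and only if $\widehat{\mathbf h}$ is an s-equivalence. -/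

import Mathlib

open CategoryTheory CategoryTheory.Limits

universe v u

/-- A diptych: a category with finite non-void products and two subcategories, the good monos `Di`
and the good epis `Ds`, subject to the diptych axioms. -/
structure Diptych (C : Type u) [Category.{v} C] [HasBinaryProducts C] where
  /-- the good monos -/
  Di : MorphismProperty C
  /-- the good epis -/
  Ds : MorphismProperty C
  di_comp : ∀ {X Y Z : C} (f : X ⟶ Y) (g : Y ⟶ Z), Di f → Di g → Di (f ≫ g)
  ds_comp : ∀ {X Y Z : C} (f : X ⟶ Y) (g : Y ⟶ Z), Ds f → Ds g → Ds (f ≫ g)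
  di_and_ds_iff : ∀ {X Y : C} (f : X ⟶ Y), (Di f ∧ Ds f) ↔ IsIso f
  di_prod : ∀ {X Y X' Y' : C} (f : X ⟶ Y) (g : X' ⟶ Y'), Di f → Di g → Di (prod.map f g)
  ds_prod : ∀ {X Y X' Y' : C} (f : X ⟶ Y) (g : X' ⟶ Y'), Ds f → Ds g → Ds (prod.map f g)
  di_mono : ∀ {X Y : C} (f : X ⟶ Y), Di f → Mono f
  ds_epi : ∀ {X Y : C} (f : X ⟶ Y), Ds f → Epi f
  /-- strong stability of the good monos -/
  di_of_comp : ∀ {X Y Z : C} (f : X ⟶ Y) (g : Y ⟶ Z), Di (f ≫ g) → Di f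
  /-- weak stability of the good epis -/
  ds_of_comp : ∀ {X Y Z : C} (f : X ⟶ Y) (g : Y ⟶ Z), Ds (f ≫ g) → Ds f → Ds g
  /-- parallel transfer -/
  transfer : ∀ {A B B' : C} (s : A ⟶ B) (i : B' ⟶ B), Ds s → Di i →
    ∃ (A' : C) (i' : A' ⟶ A) (s' : A' ⟶ B'), IsPullback i' s' s i ∧ Di i' ∧ Ds s'
  /-- descent -/
  descent : ∀ {A' A B' B : C} (i' : A' ⟶ A) (s' : A' ⟶ B') (s : A ⟶ B) (i : B' ⟶ B),
    IsPullback i' s' s i → Di i' → Ds s' → Ds s → Di i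
  isPushout : ∀ {A' A B' B : C} (t : A' ⟶ A) (s' : A' ⟶ B') (s : A ⟶ B) (t' : B' ⟶ B),
    IsPullback t s' s t' → Ds t → Ds s' → Ds s → Ds t' → IsPushout t s' s t'

namespace Diptych

variable {C : Type u} [Category.{v} C] [HasBinaryProducts C]

/-- The object `B` is s-basic: the projection `B × B ⟶ B` is a good epi. -/
def IsSBasic (D : Diptych C) (B : C) : Prop :=
  D.Ds (prod.snd : B ⨯ B ⟶ B)

/-- The square with top `u : A' ⟶ A`, left `f' : A' ⟶ B'`, right `f : A ⟶ B` and bottom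
`v : B' ⟶ B` is an ipb-square: it commutes and `(f', u) : A' ⟶ B' × A` is a good mono. -/
def IsIpb (D : Diptych C) {A' A B' B : C}
    (u : A' ⟶ A) (f' : A' ⟶ B') (f : A ⟶ B) (v : B' ⟶ B) : Prop :=
  CommSq u f' f v ∧ D.Di (prod.lift f' u)

/-- Good pullback squares: pullback squares that are also ipb-squares. -/
def IsGpb (D : Diptych C) {A' A B' B : C}
    (u : A' ⟶ A) (f' : A' ⟶ B') (f : A ⟶ B) (v : B' ⟶ B) : Prop :=
  IsPullback u f' f v ∧ D.Di (prod.lift f' u)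

/-- spb-squares: the square commutes, the pair `(v, f)` has a good pullback, and the canonical
arrow from `A'` to this pullback is a good epi. -/
def IsSpb (D : Diptych C) {A' A B' B : C}
    (u : A' ⟶ A) (f' : A' ⟶ B') (f : A ⟶ B) (v : B' ⟶ B) : Prop :=
  CommSq u f' f v ∧ ∃ (P : C) (pA : P ⟶ A) (pB' : P ⟶ B') (k : A' ⟶ P),
    D.IsGpb pA pB' f v ∧ k ≫ pA = u ∧ k ≫ pB' = f' ∧ D.Ds k

end Diptych

/-- The data of an internal groupoid: objects, arrows, source, target, units, inverses, and a
composition defined on a fibred product `pairs` of composable pairs `(a, b)`, `src a = tgt b`. -/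
structure GroupoidData (C : Type u) [Category.{v} C] where
  base : C
  arr : C
  src : arr ⟶ base
  tgt : arr ⟶ base
  unit : base ⟶ arr
  inv : arr ⟶ arr
  pairs : C
  fst : pairs ⟶ arr
  snd : pairs ⟶ arr
  isPullback : IsPullback fst snd src tgt
  comp : pairs ⟶ arr

/-- The product `a b` of two generalized elements of the object of arrows. -/
noncomputable def GroupoidData.mul {C : Type u} [Category.{v} C] (G : GroupoidData C) {X : C}
    (a b : X ⟶ G.arr) (h : a ≫ G.src = b ≫ G.tgt) : X ⟶ G.arr :=
  G.isPullback.lift a b h ≫ G.comp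

/-- A groupoid structured by the diptych `D`: an internal groupoid whose source is a good epi.
The laws are stated on generalized elements. -/
structure DGroupoid {C : Type u} [Category.{v} C] [HasBinaryProducts C] (D : Diptych C)
    extends GroupoidData C where
  src_mem : D.Ds src
  unit_src : unit ≫ src = 𝟙 base
  unit_tgt : unit ≫ tgt = 𝟙 base
  inv_src : inv ≫ src = tgt
  inv_tgt : inv ≫ tgt = src
  comp_src : comp ≫ src = snd ≫ src
  comp_tgt : comp ≫ tgt = fst ≫ tgt
  unit_mul : ∀ {X : C} (a : X ⟶ arr) (h : (a ≫ tgt ≫ unit) ≫ src = a ≫ tgt),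
    toGroupoidData.mul (a ≫ tgt ≫ unit) a h = a
  mul_unit : ∀ {X : C} (a : X ⟶ arr) (h : a ≫ src = (a ≫ src ≫ unit) ≫ tgt),
    toGroupoidData.mul a (a ≫ src ≫ unit) h = a
  inv_mul : ∀ {X : C} (a : X ⟶ arr) (h : (a ≫ inv) ≫ src = a ≫ tgt),
    toGroupoidData.mul (a ≫ inv) a h = a ≫ src ≫ unit
  mul_inv : ∀ {X : C} (a : X ⟶ arr) (h : a ≫ src = (a ≫ inv) ≫ tgt),
    toGroupoidData.mul a (a ≫ inv) h = a ≫ tgt ≫ unit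
  mul_assoc : ∀ {X : C} (a b c : X ⟶ arr) (hab : a ≫ src = b ≫ tgt) (hbc : b ≫ src = c ≫ tgt)
    (h₁ : toGroupoidData.mul a b hab ≫ src = c ≫ tgt)
    (h₂ : a ≫ src = toGroupoidData.mul b c hbc ≫ tgt),
    toGroupoidData.mul (toGroupoidData.mul a b hab) c h₁ =
      toGroupoidData.mul a (toGroupoidData.mul b c hbc) h₂

namespace DGroupoid

variable {C : Type u} [Category.{v} C] [HasBinaryProducts C] {D : Diptych C}

/-- The transitor (anchor map) `(tgt, src)`. -/
noncomputable def transitor (G : DGroupoid D) : G.arr ⟶ G.base ⨯ G.base :=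
  prod.lift G.tgt G.src

/-- Morphisms of structured groupoids, that is, internal functors. -/
@[ext]
structure Hom (H G : DGroupoid D) where
  onBase : H.base ⟶ G.base
  onArr : H.arr ⟶ G.arr
  src_comm : onArr ≫ G.src = H.src ≫ onBase
  tgt_comm : onArr ≫ G.tgt = H.tgt ≫ onBase
  unit_comm : H.unit ≫ onArr = onBase ≫ G.unit
  mul_comm : ∀ {X : C} (a b : X ⟶ H.arr) (h : a ≫ H.src = b ≫ H.tgt)
    (h' : (a ≫ onArr) ≫ G.src = (b ≫ onArr) ≫ G.tgt),
    H.mul a b h ≫ onArr = G.mul (a ≫ onArr) (b ≫ onArr) h'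

theorem Hom.composable {H G : DGroupoid D} (f : Hom H G) {X : C} (a b : X ⟶ H.arr)
    (h : a ≫ H.src = b ≫ H.tgt) :
    (a ≫ f.onArr) ≫ G.src = (b ≫ f.onArr) ≫ G.tgt := by
  rw [Category.assoc, Category.assoc, f.src_comm, f.tgt_comm, ← Category.assoc, h, Category.assoc]

/-- The category of groupoids structured by `D`. -/
instance : Category (DGroupoid D) where
  Hom := Hom
  id G :=
    { onBase := 𝟙 _
      onArr := 𝟙 _
      src_comm := by simp
      tgt_comm := by simp
      unit_comm := by simp
      mul_comm := by intros; simp }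
  comp {K H G} f g :=
    { onBase := f.onBase ≫ g.onBase
      onArr := f.onArr ≫ g.onArr
      src_comm := by rw [Category.assoc, g.src_comm, ← Category.assoc, f.src_comm, Category.assoc]
      tgt_comm := by rw [Category.assoc, g.tgt_comm, ← Category.assoc, f.tgt_comm, Category.assoc]
      unit_comm := by rw [← Category.assoc, f.unit_comm, Category.assoc, g.unit_comm, Category.assoc]
      mul_comm := by
        intro X a b h h'
        rw [← Category.assoc, f.mul_comm a b h (f.composable a b h),
          g.mul_comm _ _ _ (g.composable _ _ (f.composable a b h))]
        simp only [Category.assoc] }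
  id_comp f := by apply Hom.ext <;> exact Category.id_comp _
  comp_id f := by apply Hom.ext <;> exact Category.comp_id _
  assoc f g h := by apply Hom.ext <;> exact Category.assoc _ _ _

/-- A principal groupoid: the groupoid `B ×_Q B` of a good epi `q : B ⟶ Q`. -/
def IsPrincipal (R : DGroupoid D) : Prop :=
  ∃ (Q : C) (q : R.base ⟶ Q), D.Ds q ∧ IsPullback R.tgt R.src q q

variable {H G : DGroupoid D}

/-- Actors: the square formed by `f` and the sources is a good pullback. -/
def IsActor (f : H ⟶ G) : Prop :=
  D.IsGpb f.onArr H.src G.src f.onBase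

/-- Hypo-actors: the square formed by `f` and the sources is ipb. -/
def IsHypoActor (f : H ⟶ G) : Prop :=
  D.IsIpb f.onArr H.src G.src f.onBase

/-- Hyper-actors: the square formed by `f` and the sources is spb. -/
def IsHyperActor (f : H ⟶ G) : Prop :=
  D.IsSpb f.onArr H.src G.src f.onBase

/-- i-faithful morphisms: the square formed by `f` and the transitors is ipb. -/
def IsIFaithful (f : H ⟶ G) : Prop :=
  D.IsIpb f.onArr H.transitor G.transitor (prod.map f.onBase f.onBase)

/-- Inductors: the square formed by `f` and the transitors is a good pullback, that is, `H` is
the groupoid induced by `G` along `f.onBase`. -/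
def IsInductor (f : H ⟶ G) : Prop :=
  D.IsGpb f.onArr H.transitor G.transitor (prod.map f.onBase f.onBase)

/-- Essentially-s morphisms: the arrow from the fibred product of `f.onBase` and the source of `G`
to the base of `G` induced by the target of `G` is a good epi. -/
def IsEssentiallyS (f : H ⟶ G) : Prop :=
  ∃ (P : C) (q : P ⟶ G.arr) (a : P ⟶ H.base),
    IsPullback q a G.src f.onBase ∧ D.Ds (q ≫ G.tgt)

/-- Equivalences: essentially-s morphisms that exhibit `H` as induced by `G` along `f.onBase`. -/
def IsEquivalence (f : H ⟶ G) : Prop :=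
  IsEssentiallyS f ∧ IsInductor f

/-- i-equivalences: equivalences that are good monos on arrows. -/
def IsIEquivalence (f : H ⟶ G) : Prop :=
  IsEquivalence f ∧ D.Di f.onArr

/-- s-equivalences: inductors that are good epis on bases. -/
def IsSEquivalence (f : H ⟶ G) : Prop :=
  IsInductor f ∧ D.Ds f.onBase

/-- An activation of `f : H ⟶ G`: a factorization of `f` as a morphism followed by an actor,
through a groupoid with s-basic base. -/
structure Activation (f : H ⟶ G) where
  mid : DGroupoid D
  mid_sBasic : D.IsSBasic mid.base
  into : H ⟶ mid
  out : mid ⟶ G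
  fac : into ≫ out = f
  isActor : IsActor out

/-- An activation is universal when every activation factorizes uniquely through it. -/
def Activation.IsUniversal {f : H ⟶ G} (A : Activation f) : Prop :=
  ∀ A' : Activation f, ∃! k : A.mid ⟶ A'.mid, A.into ≫ k = A'.into ∧ k ≫ A'.out = A.out

end DGroupoid

/-- Godement's axiom: every groupoid structured by `D` whose transitor is a good mono is
principal. -/
def Diptych.IsGodement {C : Type u} [Category.{v} C] [HasBinaryProducts C] (D : Diptych C) :
    Prop :=
  ∀ R : DGroupoid D, D.Di R.transitor → R.IsPrincipal

attribute [local simp] prod.lift_fst prod.lift_snd prod.lift_fst_assoc prod.lift_snd_assoc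

/-! Let `P` be the fibred product of pairs `(g, x)` with `src g = f x`. An activation of `f` amounts
to a left `G`-action on an s-basic object, together with a suitably equivariant map `[·]` from
`H.base`. It therefore yields an orbit map `P ⟶ mid.base`, `(g, x) ↦ g · [x]`. This map is constant
on the orbits of the `H`-action `h · (g, x) = (g f(h)⁻¹, tgt h)`, so the universal candidate has
base `P / H`.

The quotient exists because i-faithfulness makes the transitor of the action groupoid of `H` on `P`
a good mono (`di_rightAction_transitor`), and Godement's axiom then makes that groupoid principal.
Left translation by `G` commutes with the `H`-action and descends to the quotient
(`Action.exists_quotient`). The middle groupoid is the resulting action groupoid, and `H` enters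
through `x ↦ [1, x]`.

All the rest follows from the property `IsQuotient`: the orbit map is a good epi, and `g · [x] =
[y]` exactly when `g = f a` for an arrow `a : x ⟶ y` of `H`, unique with this property. This gives
universality, the equivalence, and the two criteria, in which the map `a ↦ (f a, src a)` is compared
with `[·]` across a pullback square. `IsQuotient` is invariant under isomorphism, so it passes to
every universal activation.

Proofs use generalized elements; good epis allow local lifting and descent. -/

theorem CategoryTheory.IsPullback.of_forall_existsUnique {C : Type u} [Category.{v} C]
    {P X Y Z : C} {fst : P ⟶ X} {snd : P ⟶ Y} {f : X ⟶ Z} {g : Y ⟶ Z}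
    (w : fst ≫ f = snd ≫ g)
    (hex : ∀ {T : C} (a : T ⟶ X) (b : T ⟶ Y), a ≫ f = b ≫ g →
      ∃ l : T ⟶ P, l ≫ fst = a ∧ l ≫ snd = b)
    (hun : ∀ {T : C} (l m : T ⟶ P), l ≫ fst = m ≫ fst → l ≫ snd = m ≫ snd → l = m) :
    IsPullback fst snd f g := by
  refine ⟨⟨w⟩, ⟨PullbackCone.IsLimit.mk w
    (fun s => (hex s.fst s.snd s.condition).choose)
    (fun s => (hex s.fst s.snd s.condition).choose_spec.1)
    (fun s => (hex s.fst s.snd s.condition).choose_spec.2) ?_⟩⟩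
  intro s m h₁ h₂
  apply hun
  · rw [h₁, (hex s.fst s.snd s.condition).choose_spec.1]
  · rw [h₂, (hex s.fst s.snd s.condition).choose_spec.2]

/-! ### Pullbacks, descent and s-basic objects in a diptych -/

namespace Diptych

variable {C : Type u} [Category.{v} C] [HasBinaryProducts C] (D : Diptych C)

theorem di_of_isIso {X Y : C} (f : X ⟶ Y) [h : IsIso f] : D.Di f :=
  ((D.di_and_ds_iff f).2 h).1

theorem ds_of_isIso {X Y : C} (f : X ⟶ Y) [h : IsIso f] : D.Ds f :=
  ((D.di_and_ds_iff f).2 h).2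

theorem di_of_eq_comp {X Y Z : C} {f : X ⟶ Z} (a : X ⟶ Y) (b : Y ⟶ Z) (hf : D.Di f)
    (h : a ≫ b = f) : D.Di a :=
  D.di_of_comp a b (h ▸ hf)

/-- The graph `(1, v)` is a good mono because the first projection retracts it. Parallel transfer of
`1 × s` along the graph then handles an arbitrary `v`, and the good mono it produces is the ipb
condition. -/
theorem exists_isPullback {A B B' : C} (s : A ⟶ B) (hs : D.Ds s) (v : B' ⟶ B) :
    ∃ (P : C) (p : P ⟶ A) (p' : P ⟶ B'), IsPullback p p' s v ∧ D.Ds p' ∧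
      D.Di (prod.lift p' p) := by
  have hi : D.Di (prod.lift (𝟙 B') v) :=
    D.di_of_eq_comp _ prod.fst (D.di_of_isIso (𝟙 B')) (prod.lift_fst _ _)
  obtain ⟨P, i, s', hP, hi', hs'⟩ :=
    D.transfer (prod.map (𝟙 B') s) _ (D.ds_prod _ _ (D.ds_of_isIso (𝟙 B')) hs) hi
  have h₁ : i ≫ prod.fst = s' := by simpa using hP.w =≫ prod.fst
  have h₂ : (i ≫ prod.snd) ≫ s = s' ≫ v := by simpa using hP.w =≫ prod.snd
  refine ⟨P, i ≫ prod.snd, s', .of_forall_existsUnique h₂ ?_ ?_, hs', ?_⟩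
  · intro T a b h
    refine ⟨hP.lift (prod.lift b a) b (by ext <;> simp [h]), ?_, by simp⟩
    rw [hP.lift_fst_assoc, prod.lift_snd]
  · intro T l m h h'
    apply hP.hom_ext _ h'
    ext
    · simp [h₁, h']
    · simpa using h
  · convert hi'
    ext <;> simp [h₁]

variable {D}

theorem ds_and_di_of_isPullback {A' A B' B : C} {u : A' ⟶ A} {f' : A' ⟶ B'} {f : A ⟶ B}
    {v : B' ⟶ B} (h : IsPullback u f' f v) (hf : D.Ds f) :
    D.Ds f' ∧ D.Di (prod.lift f' u) := by
  obtain ⟨P, p, p', hP, hs, hi⟩ := D.exists_isPullback f hf v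
  have h₁ : (h.isoIsPullback _ _ hP).hom ≫ p' = f' := h.isoIsPullback_hom_snd _ _ hP
  have h₂ : (h.isoIsPullback _ _ hP).hom ≫ p = u := h.isoIsPullback_hom_fst _ _ hP
  constructor
  · rw [← h₁]
    exact D.ds_comp _ _ (D.ds_of_isIso _) hs
  · have : prod.lift f' u = (h.isoIsPullback _ _ hP).hom ≫ prod.lift p' p := by
      ext <;> simp
    rw [this]
    exact D.di_comp _ _ (D.di_of_isIso _) hi

theorem ds_of_isPullback {A' A B' B : C} {u : A' ⟶ A} {f' : A' ⟶ B'} {f : A ⟶ B}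
    {v : B' ⟶ B} (h : IsPullback u f' f v) (hf : D.Ds f) : D.Ds f' :=
  (ds_and_di_of_isPullback h hf).1

theorem isGpb_of_isPullback {A' A B' B : C} {u : A' ⟶ A} {f' : A' ⟶ B'} {f : A ⟶ B}
    {v : B' ⟶ B} (h : IsPullback u f' f v) (hf : D.Ds f) : D.IsGpb u f' f v :=
  ⟨h, (ds_and_di_of_isPullback h hf).2⟩

theorem cancel_ds {X Y Z : C} {s : X ⟶ Y} (hs : D.Ds s) {a b : Y ⟶ Z} (h : s ≫ a = s ≫ b) :
    a = b :=
  haveI := D.ds_epi s hs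
  (cancel_epi s).1 h

/-- Good epis are effective: arrows descend along them as soon as they identify the generalized
elements that the good epi identifies. -/
theorem exists_desc {A B X : C} {s : A ⟶ B} (hs : D.Ds s) (t : A ⟶ X)
    (h : ∀ {T : C} (a b : T ⟶ A), a ≫ s = b ≫ s → a ≫ t = b ≫ t) : ∃ l : B ⟶ X, s ≫ l = t := by
  obtain ⟨P, p, p', hP, hs', -⟩ := D.exists_isPullback s hs s
  -- Both projections of the kernel pair of `s` are good epis, so its square is a pushout.
  have hO := D.isPushout _ _ _ _ hP (ds_of_isPullback hP.flip hs) hs' hs hs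
  exact ⟨hO.desc t t (h _ _ hP.w), hO.inl_desc _ _ _⟩

/-- Generalized elements lift locally along good epis. -/
theorem exists_cover {A B T : C} {s : A ⟶ B} (hs : D.Ds s) (x : T ⟶ B) :
    ∃ (T' : C) (c : T' ⟶ T) (y : T' ⟶ A), D.Ds c ∧ y ≫ s = c ≫ x := by
  obtain ⟨P, p, p', hP, hs', -⟩ := D.exists_isPullback s hs x
  exact ⟨P, p', p, hs', hP.w⟩

theorem IsSBasic.ds_snd {B X : C} (hB : D.IsSBasic B) (v : X ⟶ B) :
    D.Ds (prod.snd : B ⨯ X ⟶ X) := by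
  refine ds_of_isPullback (u := prod.map (𝟙 B) v) (f := prod.snd) (v := v)
    (.of_forall_existsUnique (by simp) ?_ ?_) hB
  · intro T a b h
    exact ⟨prod.lift (a ≫ prod.fst) b, by ext <;> simp [h], by simp⟩
  · intro T l m h h'
    ext
    · simpa using h =≫ prod.fst
    · exact h'

theorem IsSBasic.of_ds {B P : C} (hB : D.IsSBasic B) {s : P ⟶ B} (hs : D.Ds s) :
    D.IsSBasic P := by
  have : (prod.snd : P ⨯ P ⟶ P) = prod.map s (𝟙 P) ≫ prod.snd := by simp
  rw [IsSBasic, this]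
  exact D.ds_comp _ _ (D.ds_prod _ _ hs (D.ds_of_isIso _)) (hB.ds_snd s)

theorem IsSBasic.quotient {P Q : C} (hP : D.IsSBasic P) {q : P ⟶ Q} (hq : D.Ds q) :
    D.IsSBasic Q := by
  refine D.ds_of_comp (prod.map q q) _ ?_ (D.ds_prod _ _ hq hq)
  rw [prod.map_snd]
  exact D.ds_comp _ _ hP hq

end Diptych

/-! ### Calculus with generalized elements in internal groupoids -/

section Groupoid

variable {C : Type u} [Category.{v} C]

theorem GroupoidData.comp_mul (G : GroupoidData C) {S T : C} (u : S ⟶ T) (a b : T ⟶ G.arr)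
    (h : a ≫ G.src = b ≫ G.tgt) :
    u ≫ G.mul a b h = G.mul (u ≫ a) (u ≫ b) (by simp only [Category.assoc, h]) := by
  unfold GroupoidData.mul
  rw [← Category.assoc]
  congr 1
  apply G.isPullback.hom_ext <;> simp

theorem GroupoidData.mul_congr (G : GroupoidData C) {T : C} {a a' b b' : T ⟶ G.arr}
    (h : a ≫ G.src = b ≫ G.tgt) (ha : a = a') (hb : b = b') :
    G.mul a b h = G.mul a' b' (ha ▸ hb ▸ h) := by
  subst ha hb
  rfl

end Groupoid

namespace DGroupoid

variable {C : Type u} [Category.{v} C] [HasBinaryProducts C] {D : Diptych C} (G : DGroupoid D)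

attribute [simp] unit_src unit_tgt inv_src inv_tgt

@[simp]
theorem unit_src_assoc {Z : C} (h : G.base ⟶ Z) : G.unit ≫ G.src ≫ h = h := by
  rw [reassoc_of% G.unit_src]

@[simp]
theorem unit_tgt_assoc {Z : C} (h : G.base ⟶ Z) : G.unit ≫ G.tgt ≫ h = h := by
  rw [reassoc_of% G.unit_tgt]

@[simp]
theorem inv_src_assoc {Z : C} (h : G.base ⟶ Z) : G.inv ≫ G.src ≫ h = G.tgt ≫ h := by
  rw [reassoc_of% G.inv_src]

@[simp]
theorem inv_tgt_assoc {Z : C} (h : G.base ⟶ Z) : G.inv ≫ G.tgt ≫ h = G.src ≫ h := by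
  rw [reassoc_of% G.inv_tgt]

@[simp]
theorem mul_src {T : C} (a b : T ⟶ G.arr) (h : a ≫ G.src = b ≫ G.tgt) :
    G.mul a b h ≫ G.src = b ≫ G.src := by
  simp [GroupoidData.mul, G.comp_src]

@[simp]
theorem mul_tgt {T : C} (a b : T ⟶ G.arr) (h : a ≫ G.src = b ≫ G.tgt) :
    G.mul a b h ≫ G.tgt = a ≫ G.tgt := by
  simp [GroupoidData.mul, G.comp_tgt]

@[simp]
theorem mul_src_assoc {T Z : C} (a b : T ⟶ G.arr) (h : a ≫ G.src = b ≫ G.tgt)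
    (z : G.base ⟶ Z) : G.mul a b h ≫ G.src ≫ z = b ≫ G.src ≫ z := by
  rw [reassoc_of% G.mul_src a b h]

@[simp]
theorem mul_tgt_assoc {T Z : C} (a b : T ⟶ G.arr) (h : a ≫ G.src = b ≫ G.tgt)
    (z : G.base ⟶ Z) : G.mul a b h ≫ G.tgt ≫ z = a ≫ G.tgt ≫ z := by
  rw [reassoc_of% G.mul_tgt a b h]

theorem mul_eq_right {T : C} (a b : T ⟶ G.arr) (h : a ≫ G.src = b ≫ G.tgt)
    (ha : a = b ≫ G.tgt ≫ G.unit) : G.mul a b h = b := by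
  subst ha
  exact G.unit_mul b h

theorem mul_eq_left {T : C} (a b : T ⟶ G.arr) (h : a ≫ G.src = b ≫ G.tgt)
    (hb : b = a ≫ G.src ≫ G.unit) : G.mul a b h = a := by
  subst hb
  exact G.mul_unit a h

theorem inv_mul_cancel_left {T : C} (a b : T ⟶ G.arr) (h : a ≫ G.src = b ≫ G.tgt) :
    G.mul (a ≫ G.inv) (G.mul a b h) (by simp) = b := by
  rw [← G.mul_assoc (a ≫ G.inv) a b (by simp) h (by simp [h]) (by simp)]
  apply G.mul_eq_right
  rw [G.inv_mul, reassoc_of% h]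

theorem mul_inv_cancel_left {T : C} (a b : T ⟶ G.arr) (h : a ≫ G.tgt = b ≫ G.tgt) :
    G.mul a (G.mul (a ≫ G.inv) b (by simpa using h)) (by simp) = b := by
  rw [← G.mul_assoc a (a ≫ G.inv) b (by simp) (by simpa using h) (by simp [h]) (by simp)]
  apply G.mul_eq_right
  rw [G.mul_inv, reassoc_of% h]

theorem eq_inv_of_mul_eq {T : C} (a b : T ⟶ G.arr) (h : a ≫ G.src = b ≫ G.tgt)
    (hab : G.mul a b h = a ≫ G.tgt ≫ G.unit) : b = a ≫ G.inv := by
  rw [← G.inv_mul_cancel_left a b h]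
  apply G.mul_eq_left
  rw [hab]
  simp

@[simp]
theorem inv_inv : G.inv ≫ G.inv = 𝟙 _ := by
  symm
  apply G.eq_inv_of_mul_eq G.inv (𝟙 _) (by simp)
  have := G.inv_mul (𝟙 G.arr) (by simp)
  simpa using this

instance : IsIso G.inv := ⟨G.inv, G.inv_inv, G.inv_inv⟩

theorem tgt_mem : D.Ds G.tgt := by
  rw [← G.inv_src]
  exact D.ds_comp _ _ (D.ds_of_isIso _) G.src_mem

theorem mul_comp_inv {T : C} (a b : T ⟶ G.arr) (h : a ≫ G.src = b ≫ G.tgt) :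
    G.mul a b h ≫ G.inv = G.mul (b ≫ G.inv) (a ≫ G.inv) (by simp [h]) := by
  symm
  refine G.eq_inv_of_mul_eq _ _ (by simp) ?_
  rw [G.mul_assoc a b _ h (by simp) (by simp) (by simp [h])]
  rw [G.mul_congr _ rfl (G.mul_inv_cancel_left b (a ≫ G.inv) (by simp [h])), G.mul_inv]
  simp

variable {G}

theorem comp_onArr {K H G : DGroupoid D} (f : K ⟶ H) (g : H ⟶ G) :
    (f ≫ g).onArr = f.onArr ≫ g.onArr := rfl

theorem comp_onBase {K H G : DGroupoid D} (f : K ⟶ H) (g : H ⟶ G) :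
    (f ≫ g).onBase = f.onBase ≫ g.onBase := rfl

theorem hom_ext {H G : DGroupoid D} {f g : H ⟶ G} (h₀ : f.onBase = g.onBase)
    (h₁ : f.onArr = g.onArr) : f = g :=
  Hom.ext h₀ h₁

attribute [simp] Hom.src_comm Hom.tgt_comm

@[simp]
theorem Hom.tgt_comm_assoc {H G : DGroupoid D} (f : Hom H G) {Z : C} (h : G.base ⟶ Z) :
    f.onArr ≫ G.tgt ≫ h = H.tgt ≫ f.onBase ≫ h := by
  rw [reassoc_of% f.tgt_comm]

theorem map_mul {H G : DGroupoid D} (f : H ⟶ G) {T : C} (a b : T ⟶ H.arr)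
    (h : a ≫ H.src = b ≫ H.tgt) :
    H.mul a b h ≫ f.onArr = G.mul (a ≫ f.onArr) (b ≫ f.onArr) (Hom.composable f a b h) :=
  Hom.mul_comm f a b h _

theorem inv_comm {H G : DGroupoid D} (f : H ⟶ G) : H.inv ≫ f.onArr = f.onArr ≫ G.inv := by
  refine G.eq_inv_of_mul_eq _ _ (by simp) ?_
  have := map_mul f (𝟙 _) H.inv (by simp)
  rw [G.mul_congr _ (Category.id_comp _) rfl] at this
  rw [← this]
  have h := H.mul_inv (𝟙 _) (by simp)
  rw [H.mul_congr _ rfl (Category.id_comp _)] at h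
  rw [h]
  simp [f.unit_comm]

end DGroupoid

/-! ### Groupoid actions and their action groupoids -/

namespace DGroupoid

variable {C : Type u} [Category.{v} C] [HasBinaryProducts C] {D : Diptych C}

/-- Left actions of a groupoid on an object over its base, given on generalized elements. -/
structure Action (G : DGroupoid D) (X : C) where
  anchor : X ⟶ G.base
  smul : ∀ {T : C} (a : T ⟶ G.arr) (x : T ⟶ X), a ≫ G.src = x ≫ anchor → (T ⟶ X)
  comp_smul : ∀ {S T : C} (u : S ⟶ T) (a : T ⟶ G.arr) (x : T ⟶ X)
    (h : a ≫ G.src = x ≫ anchor) (h' : (u ≫ a) ≫ G.src = (u ≫ x) ≫ anchor),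
    u ≫ smul a x h = smul (u ≫ a) (u ≫ x) h'
  smul_anchor : ∀ {T : C} (a : T ⟶ G.arr) (x : T ⟶ X) (h : a ≫ G.src = x ≫ anchor),
    smul a x h ≫ anchor = a ≫ G.tgt
  unit_smul : ∀ {T : C} (x : T ⟶ X) (h : (x ≫ anchor ≫ G.unit) ≫ G.src = x ≫ anchor),
    smul (x ≫ anchor ≫ G.unit) x h = x
  mul_smul : ∀ {T : C} (a b : T ⟶ G.arr) (x : T ⟶ X) (hab : a ≫ G.src = b ≫ G.tgt)
    (hb : b ≫ G.src = x ≫ anchor) (h₁ : G.mul a b hab ≫ G.src = x ≫ anchor)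
    (h₂ : a ≫ G.src = smul b x hb ≫ anchor),
    smul (G.mul a b hab) x h₁ = smul a (smul b x hb) h₂

namespace Action

variable {G : DGroupoid D} {X : C} (A : Action G X)

attribute [simp] smul_anchor

@[simp]
theorem smul_anchor_assoc {T Z : C} (a : T ⟶ G.arr) (x : T ⟶ X)
    (h : a ≫ G.src = x ≫ A.anchor) (z : G.base ⟶ Z) :
    A.smul a x h ≫ A.anchor ≫ z = a ≫ G.tgt ≫ z := by
  rw [reassoc_of% A.smul_anchor a x h]

theorem smul_congr {T : C} {a a' : T ⟶ G.arr} {x x' : T ⟶ X}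
    (h : a ≫ G.src = x ≫ A.anchor) (ha : a = a') (hx : x = x') :
    A.smul a x h = A.smul a' x' (ha ▸ hx ▸ h) := by
  subst ha hx
  rfl

theorem smul_eq_self {T : C} (a : T ⟶ G.arr) (x : T ⟶ X)
    (h : a ≫ G.src = x ≫ A.anchor) (ha : a = x ≫ A.anchor ≫ G.unit) : A.smul a x h = x := by
  subst ha
  exact A.unit_smul x h

theorem inv_smul_smul {T : C} (a : T ⟶ G.arr) (x : T ⟶ X)
    (h : a ≫ G.src = x ≫ A.anchor) :
    A.smul (a ≫ G.inv) (A.smul a x h) (by simp) = x := by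
  rw [← A.mul_smul (a ≫ G.inv) a x (by simp) h (by simp [h]) (by simp)]
  apply A.smul_eq_self
  rw [G.inv_mul, reassoc_of% h]

section groupoid

variable {E F : C} {e₁ : E ⟶ G.arr} {e₂ : E ⟶ X}
  (hE : IsPullback e₁ e₂ G.src A.anchor) {p q : F ⟶ E}
  (hF : IsPullback p q e₂ (A.smul e₁ e₂ hE.w))

theorem composable {T : C} (a b : T ⟶ E) (h : a ≫ e₂ = b ≫ A.smul e₁ e₂ hE.w) :
    (a ≫ e₁) ≫ G.src = (b ≫ e₁) ≫ G.tgt := by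
  rw [Category.assoc, hE.w, reassoc_of% h, A.smul_anchor, Category.assoc]

/-- The data of the action groupoid. -/
noncomputable abbrev groupoidData : GroupoidData C where
  base := X
  arr := E
  src := e₂
  tgt := A.smul e₁ e₂ hE.w
  unit := hE.lift (A.anchor ≫ G.unit) (𝟙 _) (by simp)
  inv := hE.lift (e₁ ≫ G.inv) (A.smul e₁ e₂ hE.w) (by simp)
  pairs := F
  fst := p
  snd := q
  isPullback := hF
  comp := hE.lift (G.mul (p ≫ e₁) (q ≫ e₁) (A.composable hE p q hF.w)) (q ≫ e₂) (by simp [hE.w])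

theorem groupoidData_mul_fst {T : C} (a b : T ⟶ E) (h : a ≫ e₂ = b ≫ A.smul e₁ e₂ hE.w) :
    (A.groupoidData hE hF).mul a b h ≫ e₁ =
      G.mul (a ≫ e₁) (b ≫ e₁) (A.composable hE a b h) := by
  have : (A.groupoidData hE hF).mul a b h =
    hF.lift a b h ≫ (A.groupoidData hE hF).comp := rfl
  rw [this, Category.assoc]
  change hF.lift a b h ≫ hE.lift _ _ _ ≫ e₁ = _
  rw [hE.lift_fst, GroupoidData.comp_mul]
  exact G.mul_congr _ (by simp) (by simp)

theorem groupoidData_mul_snd {T : C} (a b : T ⟶ E) (h : a ≫ e₂ = b ≫ A.smul e₁ e₂ hE.w) :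
    (A.groupoidData hE hF).mul a b h ≫ e₂ = b ≫ e₂ := by
  have : (A.groupoidData hE hF).mul a b h =
    hF.lift a b h ≫ (A.groupoidData hE hF).comp := rfl
  rw [this, Category.assoc]
  change hF.lift a b h ≫ hE.lift _ _ _ ≫ e₂ = _
  rw [hE.lift_snd, hF.lift_snd_assoc]

theorem comp_target {T : C} (a : T ⟶ E) :
    a ≫ A.smul e₁ e₂ hE.w = A.smul (a ≫ e₁) (a ≫ e₂) (by simp [hE.w]) :=
  A.comp_smul _ _ _ _ _

/-- The action groupoid. -/
noncomputable def groupoid : DGroupoid D where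
  __ := A.groupoidData hE hF
  src_mem := Diptych.ds_of_isPullback hE G.src_mem
  unit_src := hE.lift_snd _ _ _
  unit_tgt := by
    change hE.lift _ _ _ ≫ A.smul e₁ e₂ hE.w = 𝟙 _
    rw [A.comp_target hE]
    exact (A.smul_congr _ (hE.lift_fst _ _ _) (hE.lift_snd _ _ _)).trans
      (A.smul_eq_self _ _ _ (by simp))
  inv_src := hE.lift_snd _ _ _
  inv_tgt := by
    change hE.lift _ _ _ ≫ A.smul e₁ e₂ hE.w = e₂
    rw [A.comp_target hE]
    exact (A.smul_congr _ (hE.lift_fst _ _ _) (hE.lift_snd _ _ _)).trans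
      (A.inv_smul_smul _ _ _)
  comp_src := hE.lift_snd _ _ _
  comp_tgt := by
    change hE.lift _ _ _ ≫ A.smul e₁ e₂ hE.w = p ≫ A.smul e₁ e₂ hE.w
    rw [A.comp_target hE, A.comp_target hE p]
    refine (A.smul_congr _ (hE.lift_fst _ _ _) (hE.lift_snd _ _ _)).trans ?_
    refine (A.mul_smul _ _ _ _ (by simp [hE.w]) _ ?_).trans ?_
    · simpa using A.composable hE p q hF.w
    · exact A.smul_congr _ rfl (by rw [hF.w, A.comp_target hE])
  unit_mul := by
    intro T a h
    refine hE.hom_ext ?_ (A.groupoidData_mul_snd hE hF _ _ h)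
    refine (A.groupoidData_mul_fst hE hF _ _ h).trans (G.mul_eq_right _ _ _ ?_)
    change (a ≫ A.smul e₁ e₂ hE.w ≫ hE.lift _ _ _) ≫ e₁ = _
    simp
  mul_unit := by
    intro T a h
    refine hE.hom_ext ?_ ?_
    · refine (A.groupoidData_mul_fst hE hF _ _ h).trans (G.mul_eq_left _ _ _ ?_)
      change (a ≫ e₂ ≫ hE.lift _ _ _) ≫ e₁ = _
      rw [Category.assoc, Category.assoc, hE.lift_fst, Category.assoc, ← hE.w_assoc]
    · refine (A.groupoidData_mul_snd hE hF _ _ h).trans ?_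
      change (a ≫ e₂ ≫ hE.lift _ _ _) ≫ e₂ = _
      simp
  inv_mul := by
    intro T a h
    refine hE.hom_ext ?_ ?_
    · refine (A.groupoidData_mul_fst hE hF _ _ h).trans ?_
      change G.mul ((a ≫ hE.lift _ _ _) ≫ e₁) _ _ = (a ≫ e₂ ≫ hE.lift _ _ _) ≫ e₁
      rw [G.mul_congr (a' := (a ≫ e₁) ≫ G.inv) _ (by simp) rfl, G.inv_mul]
      simp [← hE.w_assoc]
    · refine (A.groupoidData_mul_snd hE hF _ _ h).trans ?_
      change _ = (a ≫ e₂ ≫ hE.lift _ _ _) ≫ e₂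
      simp
  mul_inv := by
    intro T a h
    refine hE.hom_ext ?_ ?_
    · refine (A.groupoidData_mul_fst hE hF _ _ h).trans ?_
      change G.mul _ ((a ≫ hE.lift _ _ _) ≫ e₁) _ =
        (a ≫ A.smul e₁ e₂ hE.w ≫ hE.lift _ _ _) ≫ e₁
      rw [G.mul_congr (b' := (a ≫ e₁) ≫ G.inv) _ rfl (by simp), G.mul_inv]
      simp
    · refine (A.groupoidData_mul_snd hE hF _ _ h).trans ?_
      change (a ≫ hE.lift _ _ _) ≫ e₂ = (a ≫ A.smul e₁ e₂ hE.w ≫ hE.lift _ _ _) ≫ e₂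
      simp
  mul_assoc := by
    intro T a b c hab hbc h₁ h₂
    refine hE.hom_ext ?_ ?_
    · rw [A.groupoidData_mul_fst hE hF _ _ h₁, A.groupoidData_mul_fst hE hF _ _ h₂,
        G.mul_congr _ (A.groupoidData_mul_fst hE hF _ _ hab) rfl,
        G.mul_congr (A.composable hE _ _ h₂) rfl (A.groupoidData_mul_fst hE hF _ _ hbc)]
      exact G.mul_assoc _ _ _ _ _ _ _
    · rw [A.groupoidData_mul_snd hE hF _ _ h₁, A.groupoidData_mul_snd hE hF _ _ h₂,
        A.groupoidData_mul_snd hE hF _ _ hbc]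

/-- The canonical actor from the action groupoid. -/
noncomputable def toGroupoid : A.groupoid hE hF ⟶ G where
  onBase := A.anchor
  onArr := e₁
  src_comm := hE.w
  tgt_comm := (A.smul_anchor _ _ _).symm
  unit_comm := hE.lift_fst _ _ _
  mul_comm a b h _ := A.groupoidData_mul_fst hE hF a b h

theorem isActor_toGroupoid : IsActor (A.toGroupoid hE hF) :=
  Diptych.isGpb_of_isPullback (D := D) hE G.src_mem

end groupoid

end Action

/-! ### Actors as actions, morphisms into them as equivariant maps -/

section actor

variable {H M G : DGroupoid D}

/-- An arrow of `M` is determined by its image in `G` and its source, so the base component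
determines the arrow component. -/
theorem hom_ext_of_isActor {out : M ⟶ G} (hout : IsActor out) {i j : H ⟶ M}
    (h : i ≫ out = j ≫ out) (h₀ : i.onBase = j.onBase) : i = j := by
  refine hom_ext h₀ (hout.1.hom_ext ?_ ?_)
  · exact congrArg Hom.onArr h
  · rw [Hom.src_comm, Hom.src_comm, h₀]

/-- The action on the base of the source of an actor. -/
noncomputable abbrev IsActor.action {out : M ⟶ G} (hout : IsActor out) : Action G M.base where
  anchor := out.onBase
  -- `a · x` is the target of the unique arrow over `a` that starts at `x`.
  smul a x h := hout.1.lift a x h ≫ M.tgt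
  comp_smul u a x h h' := by
    rw [← Category.assoc]
    congr 1
    apply hout.1.hom_ext <;> simp
  smul_anchor a x h := by
    rw [Category.assoc, ← Hom.tgt_comm, hout.1.lift_fst_assoc]
  unit_smul x h := by
    have : hout.1.lift _ _ h = x ≫ M.unit := by
      apply hout.1.hom_ext <;> simp [Hom.unit_comm]
    rw [this]
    simp
  mul_smul a b x hab hb h₁ h₂ := by
    have : hout.1.lift _ _ h₁ = M.mul (hout.1.lift _ _ h₂) (hout.1.lift _ _ hb)
        (by simp) := by
      apply hout.1.hom_ext
      · rw [hout.1.lift_fst, map_mul]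
        exact G.mul_congr _ (by simp) (by simp)
      · simp
    rw [this]
    simp

theorem IsActor.tgt_eq_smul {out : M ⟶ G} (hout : IsActor out) {T : C} (e : T ⟶ M.arr) :
    e ≫ M.tgt = hout.action.smul (e ≫ out.onArr) (e ≫ M.src) (by simp) := by
  change _ = hout.1.lift _ _ _ ≫ _
  congr 1
  apply hout.1.hom_ext <;> simp

/-- The equivariance of a morphism into the source of an actor. -/
theorem IsActor.tgt_onBase {out : M ⟶ G} (hout : IsActor out) {i : H ⟶ M} {f : H ⟶ G}
    (hi : i ≫ out = f) {T : C} (e : T ⟶ H.arr)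
    (h : (e ≫ f.onArr) ≫ G.src = (e ≫ H.src ≫ i.onBase) ≫ out.onBase) :
    e ≫ H.tgt ≫ i.onBase = hout.action.smul (e ≫ f.onArr) (e ≫ H.src ≫ i.onBase) h := by
  subst hi
  have := hout.tgt_eq_smul (e ≫ i.onArr)
  rw [Category.assoc, Hom.tgt_comm] at this
  rw [this]
  exact Action.smul_congr _ _ (by simp [comp_onArr]) (by simp)

/-- The arrow component is forced by `f` and the sources; equivariance of `i₀` is precisely its
compatibility with targets. This is the converse of `IsActor.tgt_onBase`. -/
theorem IsActor.exists_hom {out : M ⟶ G} (hout : IsActor out) (f : H ⟶ G)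
    (i₀ : H.base ⟶ M.base) (h₀ : i₀ ≫ out.onBase = f.onBase)
    (h : f.onArr ≫ G.src = (H.src ≫ i₀) ≫ out.onBase)
    (h₁ : H.tgt ≫ i₀ = hout.action.smul f.onArr (H.src ≫ i₀) h) :
    ∃ i : H ⟶ M, i.onBase = i₀ ∧ i ≫ out = f := by
  refine ⟨{
    onBase := i₀
    onArr := hout.1.lift f.onArr (H.src ≫ i₀) h
    src_comm := hout.1.lift_snd _ _ _
    tgt_comm := h₁.symm
    unit_comm := ?_
    mul_comm := ?_ }, rfl, hom_ext h₀ (hout.1.lift_fst _ _ _)⟩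
  · apply hout.1.hom_ext
    · simp [Hom.unit_comm, reassoc_of% h₀]
    · simp
  · intro T a b hab h'
    apply hout.1.hom_ext
    · rw [Category.assoc, hout.1.lift_fst, map_mul, map_mul]
      exact G.mul_congr _ (by simp) (by simp)
    · simp

end actor

end DGroupoid

/-! ### Activations and the consequences of the quotient property -/

namespace DGroupoid

variable {C : Type u} [Category.{v} C] [HasBinaryProducts C] {D : Diptych C}

@[simp]
theorem transitor_fst (G : DGroupoid D) : G.transitor ≫ prod.fst = G.tgt :=
  prod.lift_fst _ _

@[simp]
theorem transitor_snd (G : DGroupoid D) : G.transitor ≫ prod.snd = G.src :=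
  prod.lift_snd _ _

@[simp]
theorem transitor_fst_assoc (G : DGroupoid D) {Z : C} (z : G.base ⟶ Z) :
    G.transitor ≫ prod.fst ≫ z = G.tgt ≫ z :=
  prod.lift_fst_assoc _ _ _

@[simp]
theorem transitor_snd_assoc (G : DGroupoid D) {Z : C} (z : G.base ⟶ Z) :
    G.transitor ≫ prod.snd ≫ z = G.src ≫ z :=
  prod.lift_snd_assoc _ _ _

theorem isIso_onBase {H G : DGroupoid D} (e : H ≅ G) : IsIso e.hom.onBase :=
  ⟨e.inv.onBase, congrArg Hom.onBase e.hom_inv_id, congrArg Hom.onBase e.inv_hom_id⟩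

namespace Activation

variable {H G : DGroupoid D} {f : H ⟶ G} (A A' : Activation f) {P : C} {g : P ⟶ G.arr}
  {x : P ⟶ H.base} (hP : IsPullback g x G.src f.onBase)

theorem fac_onBase : A.into.onBase ≫ A.out.onBase = f.onBase :=
  congrArg Hom.onBase A.fac

theorem fac_onArr : A.into.onArr ≫ A.out.onArr = f.onArr :=
  congrArg Hom.onArr A.fac

/-- The action of the arrows of `G` on the image of the base of `H`. -/
noncomputable def orbit : P ⟶ A.mid.base :=
  A.isActor.action.smul g (x ≫ A.into.onBase) (by simp [hP.w, A.fac_onBase])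

theorem comp_orbit {T : C} (z : T ⟶ P) :
    z ≫ A.orbit hP = A.isActor.action.smul (z ≫ g) (z ≫ x ≫ A.into.onBase)
      (by simp [hP.w, A.fac_onBase]) :=
  A.isActor.action.comp_smul _ _ _ _ _

theorem orbit_out : A.orbit hP ≫ A.out.onBase = g ≫ G.tgt :=
  A.isActor.action.smul_anchor _ _ _

variable {A A'} in
theorem orbit_comp {k : A.mid ⟶ A'.mid} (h : A.into ≫ k = A'.into) (h' : k ≫ A'.out = A.out) :
    A.orbit hP ≫ k.onBase = A'.orbit hP := by
  have hw : g ≫ G.src = (x ≫ A.into.onBase) ≫ A.out.onBase := by simp [hP.w, A.fac_onBase]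
  have h₀ : A.into.onBase ≫ k.onBase = A'.into.onBase := congrArg Hom.onBase h
  have := A'.isActor.tgt_onBase h' (A.isActor.1.lift g (x ≫ A.into.onBase) hw)
    (by simp [hw, ← congrArg Hom.onBase h', comp_onBase])
  refine (Category.assoc _ _ _).trans (this.trans ?_)
  exact Action.smul_congr _ _ (by simp) (by simp [h₀])

/-- The arrow `a ↦ (f a, src a)`. -/
noncomputable def _root_.DGroupoid.toFibre : H.arr ⟶ P :=
  hP.lift f.onArr H.src (Hom.src_comm f)

@[simp]
theorem _root_.DGroupoid.toFibre_fst : toFibre hP ≫ g = f.onArr := hP.lift_fst _ _ _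

@[simp]
theorem _root_.DGroupoid.toFibre_snd : toFibre hP ≫ x = H.src := hP.lift_snd _ _ _

theorem toFibre_orbit : toFibre hP ≫ A.orbit hP = H.tgt ≫ A.into.onBase := by
  have := A.isActor.tgt_onBase A.fac (𝟙 _) (by simp [A.fac_onBase])
  rw [Category.id_comp] at this
  rw [this, A.comp_orbit]
  exact Action.smul_congr _ _ (by simp) (by simp [← Category.assoc])

/-- The activations whose middle base is the quotient of the fibred product `P` by `H`. -/
def IsQuotient : Prop :=
  D.Ds (A.orbit hP) ∧ IsPullback (toFibre hP) H.tgt (A.orbit hP) A.into.onBase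

variable {A hP}

theorem IsQuotient.of_iso (hA : A.IsQuotient hP) (e : A.mid ≅ A'.mid)
    (h : A.into ≫ e.hom = A'.into) (h' : e.hom ≫ A'.out = A.out) : A'.IsQuotient hP := by
  have h₀ : A.into.onBase ≫ e.hom.onBase = A'.into.onBase := congrArg Hom.onBase h
  have := isIso_onBase e
  have ho := orbit_comp hP h h'
  refine ⟨ho ▸ D.ds_comp _ _ hA.1 (D.ds_of_isIso _), ?_⟩
  refine .of_forall_existsUnique (A'.toFibre_orbit hP) ?_ fun l m => hA.2.hom_ext
  intro T a b hab
  rw [← ho, ← h₀, ← Category.assoc, ← Category.assoc, cancel_mono] at hab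
  exact ⟨hA.2.lift a b hab, by simp, by simp⟩

/-- An arrow of the middle groupoid from `[x]` to `[y]` is an arrow `g` of `G` starting at `f x`
with `g · [x] = [y]`. The pullback in `IsQuotient` says that such a `g` comes from a unique arrow `x
⟶ y` of `H`. -/
theorem IsQuotient.isInductor (hA : A.IsQuotient hP) (hf : IsIFaithful f) :
    IsInductor A.into := by
  refine ⟨.of_forall_existsUnique ?_ ?_ ?_, ?_⟩
  · ext <;> simp
  · intro T a b hab
    have ht : a ≫ A.mid.tgt = (b ≫ prod.fst) ≫ A.into.onBase := by
      simpa using hab =≫ prod.fst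
    have hs : a ≫ A.mid.src = (b ≫ prod.snd) ≫ A.into.onBase := by
      simpa using hab =≫ prod.snd
    have hw : (a ≫ A.out.onArr) ≫ G.src = (b ≫ prod.snd) ≫ f.onBase := by
      simp [reassoc_of% hs, A.fac_onBase]
    have hz : hP.lift _ _ hw ≫ A.orbit hP = (b ≫ prod.fst) ≫ A.into.onBase := by
      rw [← ht, A.isActor.tgt_eq_smul, A.comp_orbit]
      exact Action.smul_congr _ _ (by simp) (by simp [hs])
    have hl₁ : hA.2.lift _ _ hz ≫ f.onArr = a ≫ A.out.onArr := by
      rw [← toFibre_fst hP, hA.2.lift_fst_assoc, hP.lift_fst]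
    have hl₂ : hA.2.lift _ _ hz ≫ H.src = b ≫ prod.snd := by
      rw [← toFibre_snd hP, hA.2.lift_fst_assoc, hP.lift_snd]
    refine ⟨hA.2.lift _ _ hz, A.isActor.1.hom_ext ?_ ?_, ?_⟩
    · rw [Category.assoc, A.fac_onArr, hl₁]
    · rw [Category.assoc, Hom.src_comm, reassoc_of% hl₂, hs, Category.assoc]
    · ext
      · simp
      · simp [hl₂]
  · intro T l m h₁ h₂
    refine hA.2.hom_ext (hP.hom_ext ?_ ?_) ?_
    · simpa [A.fac_onArr] using h₁ =≫ A.out.onArr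
    · simpa using h₂ =≫ prod.snd
    · simpa using h₂ =≫ prod.fst
  -- The good mono `(τ_H, f₁)` given by i-faithfulness factors through `(τ_H, into₁)`; strong
  -- stability concludes.
  · refine D.di_of_eq_comp _ (prod.map (𝟙 _) A.out.onArr) hf.2 ?_
    simp [A.fac_onArr]

/-- Since `A.out` is an actor, pasting identifies `P` with the fibred product of `A.into.onBase` and
the source of the middle groupoid; the target map on it is the orbit map. -/
theorem IsQuotient.isEquivalence (hA : A.IsQuotient hP) (hf : IsIFaithful f) :
    IsEquivalence A.into := by
  have hw : g ≫ G.src = (x ≫ A.into.onBase) ≫ A.out.onBase := by simp [hP.w, A.fac_onBase]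
  refine ⟨⟨P, A.isActor.1.lift g (x ≫ A.into.onBase) hw, x, ?_, hA.1⟩, hA.isInductor hf⟩
  refine .of_right ?_ (by simp) A.isActor.1
  simpa [A.fac_onBase] using hP

theorem di_onArr_of_isInductor {K M : DGroupoid D} {i : K ⟶ M} (hi : IsInductor i)
    (h : D.Di i.onBase) : D.Di i.onArr := by
  refine D.di_of_eq_comp _ (prod.lift M.transitor (𝟙 _))
    (D.di_comp _ _ hi.2 (D.di_prod _ _ (D.di_prod _ _ h h) (D.di_of_isIso (𝟙 _)))) ?_
  ext <;> simp

theorem IsQuotient.isHypoActor_iff (hA : A.IsQuotient hP) (hf : IsIFaithful f) :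
    IsHypoActor f ↔ IsIEquivalence A.into := by
  refine ⟨fun h => ⟨hA.isEquivalence hf, di_onArr_of_isInductor (hA.isInductor hf) ?_⟩,
    fun h => ⟨⟨Hom.src_comm f⟩, ?_⟩⟩
  -- The hypo-actor condition makes `toFibre hP` a good mono; descent along the orbit map carries
  -- this to `A.into.onBase`.
  · refine D.descent _ _ _ _ hA.2 ?_ H.tgt_mem hA.1
    refine D.di_of_eq_comp _ (prod.lift x g) h.2 ?_
    ext <;> simp
  -- `(src_H, f₁)` followed by `into₀ × 1` equals `into₁` followed by the good mono `(src, out₁)` of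
  -- the actor.
  · refine D.di_of_eq_comp _ (prod.map A.into.onBase (𝟙 _))
      (D.di_comp _ _ h.2 A.isActor.2) ?_
    ext <;> simp [A.fac_onArr]

theorem IsQuotient.isHyperActor_iff (hA : A.IsQuotient hP) (hf : IsIFaithful f) :
    IsHyperActor f ↔ IsSEquivalence A.into := by
  constructor
  · rintro ⟨-, P', p, p', k, hP', h₁, h₂, hk⟩
    -- By weak stability it is enough that `tgt ≫ into₀ = toFibre ≫ orbit` is a good epi, and
    -- `toFibre hP` is `k` up to isomorphism.
    refine ⟨hA.isInductor hf, D.ds_of_comp H.tgt _ ?_ H.tgt_mem⟩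
    rw [← A.toFibre_orbit hP]
    refine D.ds_comp _ _ ?_ hA.1
    have : toFibre hP = k ≫ (hP'.1.isoIsPullback _ _ hP).hom := by
      apply hP.hom_ext <;> simp [h₁, h₂]
    rw [this]
    exact D.ds_comp _ _ hk (D.ds_of_isIso _)
  · intro h
    exact ⟨⟨Hom.src_comm f⟩, P, g, x, toFibre hP, Diptych.isGpb_of_isPullback hP G.src_mem,
      toFibre_fst hP, toFibre_snd hP, Diptych.ds_of_isPullback hA.2.flip h.2⟩

/-- If `(g, x)` and `(g', x')` have the same image, then `g'⁻¹g · [x] = [x']`, so `g'⁻¹g = f l` for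
an arrow `l : x ⟶ x'` of `H`. Every other activation then satisfies the same relation, and acting by
`g'` gives the equality there. This is what lets `A'.orbit hP` descend. -/
theorem IsQuotient.orbit_eq (hA : A.IsQuotient hP) {T : C} (z w : T ⟶ P)
    (h : z ≫ A.orbit hP = w ≫ A.orbit hP) : z ≫ A'.orbit hP = w ≫ A'.orbit hP := by
  have ht : (z ≫ g) ≫ G.tgt = (w ≫ g) ≫ G.tgt := by
    simpa [A.orbit_out] using h =≫ A.out.onBase
  have hb : G.mul ((w ≫ g) ≫ G.inv) (z ≫ g) (by simpa using ht.symm) ≫ G.src =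
      (z ≫ x) ≫ f.onBase := by simp [hP.w]
  have hz : hP.lift _ _ hb ≫ A.orbit hP = (w ≫ x) ≫ A.into.onBase := by
    rw [A.comp_orbit]
    refine (Action.smul_congr _ _ (hP.lift_fst _ _ _)
      (x' := z ≫ x ≫ A.into.onBase) (by simp)).trans ?_
    rw [A.isActor.action.mul_smul _ _ _ (by simpa using ht.symm)
      (by simp [hP.w, A.fac_onBase]) _ (by rw [Action.smul_anchor]; simpa using ht.symm)]
    refine (Action.smul_congr _ _ (a' := (w ≫ g) ≫ G.inv) rfl
      (((A.comp_orbit hP z).symm.trans h).trans (A.comp_orbit hP w))).trans ?_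
    rw [A.isActor.action.inv_smul_smul, Category.assoc]
  obtain ⟨l, hl₁, hl₂⟩ : ∃ l : T ⟶ H.arr, l ≫ toFibre hP = hP.lift _ _ hb ∧ l ≫ H.tgt = w ≫ x :=
    ⟨hA.2.lift _ _ hz, by simp, by simp⟩
  have hl := hl₁ =≫ A'.orbit hP
  rw [Category.assoc, A'.toFibre_orbit, reassoc_of% hl₂, A'.comp_orbit] at hl
  rw [A'.comp_orbit hP w, A'.comp_orbit hP z]
  symm
  refine (Action.smul_congr _ _ rfl (hl.trans (Action.smul_congr _ _ (hP.lift_fst _ _ _)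
      (x' := z ≫ x ≫ A'.into.onBase) (by simp)))).trans ?_
  rw [← A'.isActor.action.mul_smul _ _ _ (by simp) _ (by simp [hP.w, A'.fac_onBase])]
  exact Action.smul_congr _ _ (G.mul_inv_cancel_left _ _ ht.symm) rfl

theorem exists_section (hP : IsPullback g x G.src f.onBase) :
    ∃ s : H.base ⟶ P, s ≫ g = f.onBase ≫ G.unit ∧ s ≫ x = 𝟙 _ :=
  ⟨hP.lift (f.onBase ≫ G.unit) (𝟙 _) (by simp), by simp, by simp⟩

theorem section_orbit {s : H.base ⟶ P} (h₁ : s ≫ g = f.onBase ≫ G.unit) (h₂ : s ≫ x = 𝟙 _) :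
    s ≫ A.orbit hP = A.into.onBase := by
  rw [A.comp_orbit]
  rw [A.isActor.action.smul_eq_self]
  · rw [reassoc_of% h₂]
  · rw [h₁, Category.assoc, Category.assoc, reassoc_of% A.fac_onBase, reassoc_of% h₂]

theorem IsQuotient.isUniversal (hA : A.IsQuotient hP) : A.IsUniversal := by
  intro A'
  obtain ⟨k₀, hk₀⟩ := Diptych.exists_desc hA.1 (A'.orbit hP) (hA.orbit_eq A')
  obtain ⟨s, hs₁, hs₂⟩ := exists_section hP
  have hi₀ : A.into.onBase ≫ k₀ = A'.into.onBase := by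
    rw [← section_orbit (hP := hP) hs₁ hs₂, Category.assoc, hk₀, section_orbit hs₁ hs₂]
  have hko : k₀ ≫ A'.out.onBase = A.out.onBase := by
    apply Diptych.cancel_ds hA.1
    rw [reassoc_of% hk₀, A'.orbit_out, A.orbit_out]
  have hw : A.out.onArr ≫ G.src = (A.mid.src ≫ k₀) ≫ A'.out.onBase := by simp [hko]
  obtain ⟨k, hk, hk'⟩ := A'.isActor.exists_hom A.out k₀ hko hw (by
    -- Equivariance of `k₀` may be checked after a cover on which the source is the orbit of some
    -- `z`; there it reduces to equivariance of both orbit maps (`key`).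
    obtain ⟨T, c, z, hc, hz⟩ := Diptych.exists_cover hA.1 A.mid.src
    apply Diptych.cancel_ds hc
    have hzw : (c ≫ A.out.onArr) ≫ G.src = (z ≫ g) ≫ G.tgt := by
      rw [Category.assoc, Category.assoc, Hom.src_comm, ← A.orbit_out hP, reassoc_of% hz]
    have hy : G.mul _ _ hzw ≫ G.src = (z ≫ x) ≫ f.onBase := by simp [hP.w]
    have key : ∀ B : Activation f, hP.lift _ _ hy ≫ B.orbit hP =
        B.isActor.action.smul (c ≫ A.out.onArr) (z ≫ B.orbit hP)
          (by rw [hzw, Category.assoc, Category.assoc]; exact (z ≫= B.orbit_out hP).symm) := by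
      intro B
      rw [B.comp_orbit]
      refine (Action.smul_congr _ _ (hP.lift_fst _ _ _)
        (x' := z ≫ x ≫ B.into.onBase) (by simp)).trans ?_
      rw [B.isActor.action.mul_smul _ _ _ hzw (by simp [hP.w, B.fac_onBase]) _
        (by rw [hzw, Action.smul_anchor])]
      exact Action.smul_congr _ _ rfl (B.comp_orbit hP z).symm
    have h₁ : c ≫ A.mid.tgt = hP.lift _ _ hy ≫ A.orbit hP := by
      rw [key, A.isActor.tgt_eq_smul]
      exact Action.smul_congr _ _ rfl hz.symm
    rw [reassoc_of% h₁, hk₀, key, A'.isActor.action.comp_smul _ _ _ _ (by simp [hko])]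
    exact Action.smul_congr _ _ rfl (by rw [← hk₀, reassoc_of% hz]))
  refine ⟨k, ⟨?_, hk'⟩, ?_⟩
  · apply hom_ext_of_isActor A'.isActor
    · rw [Category.assoc, hk', A.fac, A'.fac]
    · rw [comp_onBase, hk, hi₀]
  · rintro l ⟨hl, hl'⟩
    apply hom_ext_of_isActor A'.isActor (by rw [hl', hk'])
    apply Diptych.cancel_ds hA.1
    rw [orbit_comp hP hl hl', hk, hk₀]

end Activation

end DGroupoid

/-! ### Construction of the quotient activation -/

namespace DGroupoid

variable {C : Type u} [Category.{v} C] [HasBinaryProducts C] {D : Diptych C}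

/-- An action descends along a good epi that is compatible with it. -/
theorem Action.exists_quotient {G : DGroupoid D} {P Q : C} (B : Action G P) {q : P ⟶ Q}
    (hq : D.Ds q)
    (hanchor : ∀ {T : C} (z w : T ⟶ P), z ≫ q = w ≫ q → z ≫ B.anchor = w ≫ B.anchor)
    (hsmul : ∀ {T : C} (b : T ⟶ G.arr) (z w : T ⟶ P) (hz : b ≫ G.src = z ≫ B.anchor)
      (hw : b ≫ G.src = w ≫ B.anchor), z ≫ q = w ≫ q → B.smul b z hz ≫ q = B.smul b w hw ≫ q) :
    ∃ A : Action G Q, q ≫ A.anchor = B.anchor ∧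
      ∀ {T : C} (b : T ⟶ G.arr) (z : T ⟶ P) (h : b ≫ G.src = (z ≫ q) ≫ A.anchor)
        (h' : b ≫ G.src = z ≫ B.anchor), A.smul b (z ≫ q) h = B.smul b z h' ≫ q := by
  obtain ⟨anchor, han⟩ := Diptych.exists_desc hq B.anchor hanchor
  obtain ⟨E, e₁, e₂, hE, -, -⟩ := D.exists_isPullback G.src G.src_mem anchor
  -- `E'` consists of pairs in `E` with a lift to `P` of their point of `Q`. It covers `E`, so the
  -- action map descends along `c`.
  obtain ⟨E', p, c, hE', hc, -⟩ := D.exists_isPullback q hq e₂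
  have hcp : (c ≫ e₁) ≫ G.src = p ≫ B.anchor := by
    rw [Category.assoc, hE.w, ← han, ← Category.assoc, ← Category.assoc, hE'.w]
  obtain ⟨act, hact⟩ := Diptych.exists_desc hc (B.smul (c ≫ e₁) p hcp ≫ q) (by
    intro T a b hab
    have h : ∀ t : T ⟶ E', (t ≫ c ≫ e₁) ≫ G.src = (t ≫ p) ≫ B.anchor := fun t => by
      rw [Category.assoc, hcp, Category.assoc]
    rw [← Category.assoc, ← Category.assoc, B.comp_smul _ _ _ _ (h a), B.comp_smul _ _ _ _ (h b),
      B.smul_congr (h a) (a' := b ≫ c ≫ e₁) (by rw [reassoc_of% hab]) rfl]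
    apply hsmul
    rw [Category.assoc, Category.assoc, hE'.w, reassoc_of% hab])
  have key : ∀ {T : C} (b : T ⟶ G.arr) (z : T ⟶ P) (h : b ≫ G.src = (z ≫ q) ≫ anchor)
      (h' : b ≫ G.src = z ≫ B.anchor), hE.lift b (z ≫ q) h ≫ act = B.smul b z h' ≫ q := by
    intro T b z h h'
    have hl : z ≫ q = hE.lift b (z ≫ q) h ≫ e₂ := by simp
    rw [← hE'.lift_snd z (hE.lift b (z ≫ q) h) hl, Category.assoc, hact, ← Category.assoc,
      B.comp_smul _ _ _ _ (by simpa [← reassoc_of% hl, han] using h')]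
    congr 1
    exact B.smul_congr _ (by simp) (by simp)
  have hcomp : ∀ {S T : C} (u : S ⟶ T) (a : T ⟶ G.arr) (y : T ⟶ Q) (h : a ≫ G.src = y ≫ anchor)
      (h' : (u ≫ a) ≫ G.src = (u ≫ y) ≫ anchor),
      u ≫ hE.lift a y h ≫ act = hE.lift (u ≫ a) (u ≫ y) h' ≫ act := by
    intro S T u a y h h'
    rw [← Category.assoc]
    congr 1
    apply hE.hom_ext <;> simp
  have hlift : ∀ {T : C} {a a' : T ⟶ G.arr} {y y' : T ⟶ Q} (h : a ≫ G.src = y ≫ anchor)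
      (ha : a = a') (hy : y = y'),
      hE.lift a y h ≫ act = hE.lift a' y' (ha ▸ hy ▸ h) ≫ act := by
    rintro T a _ y _ h rfl rfl
    rfl
  -- On a cover where `y` lifts to `z`, the new action is computed by that of `P`; the action laws
  -- follow by local lifting.
  have hloc : ∀ {T : C} (a : T ⟶ G.arr) (y : T ⟶ Q) (h : a ≫ G.src = y ≫ anchor) {S : C}
      (s : S ⟶ T) (z : S ⟶ P) (hz : z ≫ q = s ≫ y) (h' : (s ≫ a) ≫ G.src = z ≫ B.anchor),
      s ≫ hE.lift a y h ≫ act = B.smul (s ≫ a) z h' ≫ q := by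
    intro T a y h S s z hz h'
    rw [hcomp s a y h (by simp [h]), ← key (s ≫ a) z (by simp [hz, h])]
    exact hlift _ rfl hz.symm
  have hsrc : ∀ {T : C} (a : T ⟶ G.arr) (y : T ⟶ Q), a ≫ G.src = y ≫ anchor → ∀ {S : C}
      (s : S ⟶ T) (z : S ⟶ P), z ≫ q = s ≫ y → (s ≫ a) ≫ G.src = z ≫ B.anchor := by
    intro T a y h S s z hz
    rw [← han, reassoc_of% hz, Category.assoc, h]
  refine ⟨{
    anchor := anchor
    smul := fun a y h => hE.lift a y h ≫ act
    comp_smul := hcomp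
    smul_anchor := ?_
    unit_smul := ?_
    mul_smul := ?_ }, han, key⟩
  · intro T a y h
    obtain ⟨S, s, z, hs, hz⟩ := Diptych.exists_cover hq y
    apply Diptych.cancel_ds hs
    have := hloc a y h s z hz (hsrc a y h s z hz) =≫ anchor
    simp only [Category.assoc] at this
    rw [Category.assoc, this, han, B.smul_anchor, Category.assoc]
  · intro T y h
    obtain ⟨S, s, z, hs, hz⟩ := Diptych.exists_cover hq y
    apply Diptych.cancel_ds hs
    rw [hloc _ y h s z hz (hsrc _ y h s z hz), B.smul_eq_self, hz]
    rw [← han, Category.assoc, reassoc_of% hz]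
  · intro T a b y hab hb h₁ h₂
    obtain ⟨S, s, z, hs, hz⟩ := Diptych.exists_cover hq y
    apply Diptych.cancel_ds hs
    have hb' := hsrc _ y hb s z hz
    have hab' : (s ≫ a) ≫ G.src = (s ≫ b) ≫ G.tgt := by simp [hab]
    rw [hloc _ y h₁ s z hz (hsrc _ y h₁ s z hz),
      hloc a _ h₂ s (B.smul _ z hb') (hloc b y hb s z hz hb').symm (by simpa using hab')]
    congr 1
    refine (B.smul_congr _ (G.comp_mul _ _ _ _) rfl).trans ?_
    exact B.mul_smul _ _ _ hab' _ _ _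

section fibre

variable {H G : DGroupoid D} {f : H ⟶ G} {P : C} {g : P ⟶ G.arr}
  {x : P ⟶ H.base}

theorem rightAction_composable (hP : IsPullback g x G.src f.onBase) {T : C} (h : T ⟶ H.arr)
    (z : T ⟶ P) (hz : h ≫ H.src = z ≫ x) :
    (z ≫ g) ≫ G.src = (h ≫ H.inv ≫ f.onArr) ≫ G.tgt := by
  simp [hP.w, reassoc_of% hz]

variable (hP : IsPullback g x G.src f.onBase)

/-- The action of `G` by left translations on the fibred product of its source and `f`. -/
noncomputable abbrev leftAction : Action G P where
  anchor := g ≫ G.tgt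
  smul b z h := hP.lift (G.mul b (z ≫ g) (by simpa using h)) (z ≫ x) (by simp [hP.w])
  comp_smul u b z h h' := by
    apply hP.hom_ext
    · rw [Category.assoc, hP.lift_fst, hP.lift_fst, GroupoidData.comp_mul]
      exact G.mul_congr _ rfl (by simp)
    · simp
  smul_anchor b z h := by simp
  unit_smul z h := by
    apply hP.hom_ext
    · rw [hP.lift_fst]
      exact G.mul_eq_right _ _ _ (by simp)
    · simp
  mul_smul a b z hab hb h₁ h₂ := by
    apply hP.hom_ext
    · rw [hP.lift_fst, hP.lift_fst, G.mul_assoc a b (z ≫ g) hab (by simpa using hb)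
        (by simpa using h₁) (by simpa using hab)]
      exact G.mul_congr _ rfl (by simp)
    · simp

/-- The action of `H` by right translations, made into a left action, on the fibred product of
`f` and the source of `G`. -/
noncomputable abbrev rightAction : Action H P where
  anchor := x
  smul h z hz := hP.lift (G.mul (z ≫ g) (h ≫ H.inv ≫ f.onArr) (rightAction_composable hP h z hz))
    (h ≫ H.tgt) (by simp)
  comp_smul u b z h h' := by
    apply hP.hom_ext
    · rw [Category.assoc, hP.lift_fst, hP.lift_fst, GroupoidData.comp_mul]
      exact G.mul_congr _ (by simp) (by simp)
    · simp
  smul_anchor b z h := by simp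
  unit_smul z h := by
    apply hP.hom_ext
    · rw [hP.lift_fst]
      refine G.mul_eq_left _ _ _ ?_
      have : H.unit ≫ H.inv = H.unit := by
        symm
        refine H.eq_inv_of_mul_eq _ _ (by simp) ?_
        rw [H.mul_eq_right _ _ _ (by simp)]
        simp
      simp [reassoc_of% this, reassoc_of% hP.w, Hom.unit_comm]
    · simp
  mul_smul a b z hab hb h₁ h₂ := by
    apply hP.hom_ext
    · rw [hP.lift_fst, hP.lift_fst]
      refine (G.mul_congr _ rfl (b' := G.mul (b ≫ H.inv ≫ f.onArr) (a ≫ H.inv ≫ f.onArr)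
        (by simp [reassoc_of% hab])) ?_).trans ?_
      · rw [← Category.assoc, H.mul_comp_inv, map_mul]
        exact G.mul_congr _ (by simp) (by simp)
      · rw [← G.mul_assoc _ _ _ (rightAction_composable hP b z hb) _
          (by simp [reassoc_of% hab])]
        exact G.mul_congr _ (by simp) rfl
    · simp

/-- This is associativity in `G`: `b (g f(h)⁻¹) = (b g) f(h)⁻¹`. It is what makes left translation
compatible with the quotient by `H`. -/
theorem leftAction_smul_rightAction_smul {T : C} (b : T ⟶ G.arr) (h : T ⟶ H.arr) (z : T ⟶ P)
    (hz : h ≫ H.src = z ≫ x) (hb : b ≫ G.src = z ≫ g ≫ G.tgt)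
    (hb' : b ≫ G.src = (rightAction hP).smul h z hz ≫ g ≫ G.tgt)
    (hz' : h ≫ H.src = (leftAction hP).smul b z hb ≫ x) :
    (leftAction hP).smul b ((rightAction hP).smul h z hz) hb' =
      (rightAction hP).smul h ((leftAction hP).smul b z hb) hz' := by
  apply hP.hom_ext
  · refine (hP.lift_fst _ _ _).trans (Eq.trans ?_ (hP.lift_fst _ _ _).symm)
    refine (G.mul_congr _ rfl (hP.lift_fst _ _ _)).trans ?_
    rw [← G.mul_assoc b _ _ (by simpa using hb) (rightAction_composable hP h z hz)
      (by simpa using rightAction_composable hP h z hz)]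
    exact G.mul_congr _ (by simp) rfl
  · simp

/-- The map `(h, z) ↦ (h z, z)` is a good mono when `f` is i-faithful. -/
theorem di_rightAction_transitor (hf : IsIFaithful f) {E : C} {e₁ : E ⟶ H.arr} {e₂ : E ⟶ P}
    (hE : IsPullback e₁ e₂ H.src x) :
    D.Di (prod.lift ((rightAction hP).smul e₁ e₂ hE.w) e₂) := by
  have h₁ : D.Di (prod.lift e₂ e₁) := (Diptych.ds_and_di_of_isPullback hE H.src_mem).2
  have h₂ : D.Di (H.inv ≫ prod.lift H.transitor f.onArr) :=
    D.di_comp _ _ (D.di_of_isIso _) hf.2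
  have h₃ := D.di_comp _ _ h₁ (D.di_prod _ _ (D.di_of_isIso (𝟙 P)) h₂)
  -- The component `src h` in `h₃` is redundant, being the anchor of `z`.
  have h₄ : D.Di (prod.lift e₂ (prod.lift (e₁ ≫ H.tgt) (e₁ ≫ H.inv ≫ f.onArr))) := by
    refine D.di_of_eq_comp _ (prod.lift prod.fst (prod.lift
      (prod.lift (prod.fst ≫ x) (prod.snd ≫ prod.fst)) (prod.snd ≫ prod.snd))) h₃ ?_
    ext <;> simp [hE.w]
  obtain ⟨F, k, w, hF, -, -⟩ := D.exists_isPullback G.tgt G.tgt_mem (g ≫ G.src)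
  have hwk : (w ≫ g) ≫ G.src = k ≫ G.tgt := by rw [hF.w, Category.assoc]
  -- The shear `(k, w) ↦ (g(w) k, w)` is invertible, so `F` is also a fibred product of targets.
  -- This trades `f(h⁻¹)` in `h₄` for the product `g f(h⁻¹)`, the entry that appears in `h · z`.
  have hF' : IsPullback (G.mul (w ≫ g) k hwk) w G.tgt (g ≫ G.tgt) := by
    refine .of_forall_existsUnique (by simp) ?_ ?_
    · intro T a b hab
      have hba : ((b ≫ g) ≫ G.inv) ≫ G.src = a ≫ G.tgt := by simp [hab]
      have hl : G.mul _ _ hba ≫ G.tgt = b ≫ g ≫ G.src := by simp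
      refine ⟨hF.lift _ _ hl, ?_, by simp⟩
      rw [G.comp_mul]
      refine (G.mul_congr _ (a' := b ≫ g) (by simp) (hF.lift_fst _ _ _)).trans ?_
      exact G.mul_inv_cancel_left _ _ (by simp [hab])
    · intro T l m h h'
      refine hF.hom_ext ?_ h'
      rw [G.comp_mul, G.comp_mul] at h
      rw [← G.inv_mul_cancel_left (l ≫ w ≫ g) (l ≫ k) (by simp [hF.w]),
        ← G.inv_mul_cancel_left (m ≫ w ≫ g) (m ≫ k) (by simp [hF.w])]
      exact G.mul_congr _ (by rw [reassoc_of% h']) h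
  have h₅ : D.Di (prod.lift w (G.mul (w ≫ g) k hwk)) :=
    (Diptych.ds_and_di_of_isPullback hF' G.tgt_mem).2
  have hl : (e₁ ≫ H.inv ≫ f.onArr) ≫ G.tgt = e₂ ≫ g ≫ G.src := by
    simp [hP.w, reassoc_of% hE.w]
  have h₆ : D.Di (prod.lift (hF.lift _ _ hl) (e₁ ≫ H.tgt)) := by
    refine D.di_of_eq_comp _ (prod.lift (prod.fst ≫ w) (prod.lift prod.snd (prod.fst ≫ k))) h₄ ?_
    ext <;> simp
  have h₇ := D.di_comp _ _ h₆ (D.di_prod _ _ h₅ (D.di_of_isIso (𝟙 H.base)))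
  refine D.di_of_eq_comp _ (prod.lift (prod.lift prod.snd (prod.fst ≫ g)) (prod.fst ≫ x)) h₇ ?_
  ext
  · simp
  · simp only [prod.comp_lift, prod.lift_map, prod.lift_fst, prod.lift_snd, prod.lift_fst_assoc,
      IsPullback.lift_fst]
    rw [G.comp_mul]
    exact G.mul_congr _ (by simp) (by simp)
  · simp

theorem exists_isQuotient (hD : D.IsGodement) (hH : D.IsSBasic H.base) (hf : IsIFaithful f) :
    ∃ A : Activation f, A.IsQuotient hP := by
  obtain ⟨E, e₁, e₂, hE, he, -⟩ := D.exists_isPullback H.src H.src_mem x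
  obtain ⟨F, p, p', hF, -, -⟩ := D.exists_isPullback e₂ he ((rightAction hP).smul e₁ e₂ hE.w)
  obtain ⟨Q, q, hq, hR⟩ : ∃ (Q : C) (q : P ⟶ Q), D.Ds q ∧
      IsPullback ((rightAction hP).smul e₁ e₂ hE.w) e₂ q q :=
    hD ((rightAction hP).groupoid hE hF) (di_rightAction_transitor hP hf hE)
  -- `hinv` and `htrans` say that `q` identifies exactly the points in the same `H`-orbit.
  have hinv : ∀ {T : C} (h : T ⟶ H.arr) (z : T ⟶ P) (hz : h ≫ H.src = z ≫ x),
      (rightAction hP).smul h z hz ≫ q = z ≫ q := by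
    intro T h z hz
    have := hE.lift h z hz ≫= hR.w
    rw [hE.lift_snd_assoc, ← Category.assoc, Action.comp_smul _ _ _ _ _ (by simp [hz])] at this
    rw [← this]
    congr 1
    exact Action.smul_congr _ _ (by simp) (by simp)
  have htrans : ∀ {T : C} (z w : T ⟶ P), z ≫ q = w ≫ q → ∃ (h : T ⟶ H.arr)
      (hz : h ≫ H.src = z ≫ x), (rightAction hP).smul h z hz = w := by
    intro T z w hzw
    refine ⟨hR.lift w z hzw.symm ≫ e₁, by simp [hE.w], ?_⟩
    conv_rhs => rw [← hR.lift_fst w z hzw.symm,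
      Action.comp_smul _ _ _ _ _ (by simp [hE.w])]
    exact Action.smul_congr _ _ rfl (by simp)
  obtain ⟨A, hA, hA'⟩ := (leftAction hP).exists_quotient hq
    (by
      intro T z w hzw
      obtain ⟨h, hz, rfl⟩ := htrans z w hzw
      simp)
    (by
      intro T b z w hz hw hzw
      obtain ⟨h, hz', rfl⟩ := htrans z w hzw
      rw [leftAction_smul_rightAction_smul hP b h z hz' hz hw (by simpa using hz'), hinv])
  obtain ⟨M, m, m', hM, hm, -⟩ := D.exists_isPullback G.src G.src_mem A.anchor
  obtain ⟨N, n, n', hN, -, -⟩ := D.exists_isPullback m' hm (A.smul m m' hM.w)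
  have hact := A.isActor_toGroupoid hM hN
  obtain ⟨s, hs₁, hs₂⟩ := Activation.exists_section hP
  have hsq : (s ≫ q) ≫ A.anchor = f.onBase := by
    rw [Category.assoc, hA, reassoc_of% hs₁]
    simp
  have hsmul : ∀ {T : C} (b : T ⟶ G.arr) (y : T ⟶ Q) (h : b ≫ G.src = y ≫ A.anchor),
      hact.action.smul b y h = A.smul b y h := by
    intro T b y h
    change hM.lift b y h ≫ A.smul m m' hM.w = _
    rw [A.comp_smul _ _ _ _ (by simp [h])]
    exact A.smul_congr _ (by simp) (by simp)
  -- `b · [1, y] = [b, y]`, which later identifies the orbit map with `q`.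
  have hsec : ∀ {T : C} (b : T ⟶ G.arr) (y : T ⟶ H.base)
      (h : b ≫ G.src = (y ≫ s ≫ q) ≫ A.anchor) (h' : b ≫ G.src = y ≫ f.onBase),
      A.smul b (y ≫ s ≫ q) h = hP.lift b y h' ≫ q := by
    intro T b y h h'
    refine (A.smul_congr _ rfl (Category.assoc _ _ _).symm).trans
      ((hA' _ _ _ (by simp [reassoc_of% hs₁, h'])).trans ?_)
    congr 1
    apply hP.hom_ext
    · rw [hP.lift_fst, hP.lift_fst]
      exact G.mul_eq_left _ _ _ (by simp [hs₁, reassoc_of% h'])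
    · simp [hs₂]
  -- `h · (f h, src h) = (1, tgt h)`: this gives the equivariance of `x ↦ [1, x]`.
  have hfib : ∀ {T : C} (h : T ⟶ H.arr), (rightAction hP).smul h (h ≫ toFibre hP) (by simp) =
      h ≫ H.tgt ≫ s := by
    intro T h
    apply hP.hom_ext
    · refine (hP.lift_fst _ _ _).trans ?_
      refine (G.mul_congr _ (a' := h ≫ f.onArr) (b' := (h ≫ f.onArr) ≫ G.inv) (by simp)
        (by simp [inv_comm])).trans ?_
      rw [G.mul_inv]
      simp [hs₁]
    · simp [hs₂]
  have hfib' : toFibre hP ≫ q = H.tgt ≫ s ≫ q := by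
    have := hfib (𝟙 _) =≫ q
    rw [hinv] at this
    simpa using this
  obtain ⟨i, hi, hi'⟩ := hact.exists_hom f (s ≫ q) hsq
    ((Hom.src_comm f).trans (by rw [Category.assoc]; exact congrArg _ hsq.symm)) (by
      exact hfib'.symm.trans
        ((hsmul _ _ _).trans (hsec _ _ _ (Hom.src_comm f))).symm)
  have hPx : D.Ds x := Diptych.ds_of_isPullback hP G.src_mem
  refine ⟨⟨A.groupoid hM hN, (hH.of_ds hPx).quotient hq, i, A.toGroupoid hM hN, hi', hact⟩, ?_⟩
  have horb : Activation.orbit (⟨A.groupoid hM hN, (hH.of_ds hPx).quotient hq, i,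
      A.toGroupoid hM hN, hi', hact⟩ : Activation f) hP = q := by
    refine (hsmul _ _ _).trans ?_
    refine (A.smul_congr _ rfl (x' := x ≫ s ≫ q) (congrArg (x ≫ ·) hi)).trans ?_
    rw [hsec g x _ hP.w]
    have : hP.lift g x hP.w = 𝟙 P := by apply hP.hom_ext <;> simp
    rw [this, Category.id_comp]
  rw [Activation.IsQuotient, horb]
  refine ⟨hq, ?_⟩
  change IsPullback (toFibre hP) H.tgt q i.onBase
  rw [hi]
  refine .of_forall_existsUnique hfib' ?_ ?_
  · intro T z y hzy
    -- If `[z] = [1, y]`, some `h` carries `z` to `(1, y)`. It also carries `(f h, src h)` there, so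
    -- cancelling `h` gives `z = (f h, src h)`.
    obtain ⟨h, hz, hh⟩ := htrans z (y ≫ s) (hzy.trans (Category.assoc _ _ _).symm)
    have ht : h ≫ H.tgt = y := by
      simpa [hs₂] using hh =≫ x
    refine ⟨h, ?_, ht⟩
    have hh' : (rightAction hP).smul h (h ≫ toFibre hP) (by simp) =
        (rightAction hP).smul h z hz := by
      rw [hfib, hh, reassoc_of% ht]
    rw [← (rightAction hP).inv_smul_smul h (h ≫ toFibre hP) (by simp),
      ← (rightAction hP).inv_smul_smul h z hz]
    exact Action.smul_congr _ _ rfl hh'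
  · intro T l m h h'
    have hl : ∀ l : T ⟶ H.arr, l ≫ H.src = (l ≫ toFibre hP) ≫ x := by simp
    have key : ∀ l : T ⟶ H.arr, hE.lift l _ (hl l) ≫ (rightAction hP).smul e₁ e₂ hE.w =
        l ≫ H.tgt ≫ s := by
      intro l
      rw [Action.comp_smul _ _ _ _ _ (by simp), ← hfib]
      exact Action.smul_congr _ _ (by simp) (by simp)
    -- Freeness of the `H`-action: the two maps of the kernel pair `E` are jointly monic.
    have : hE.lift l _ (hl l) = hE.lift m _ (hl m) := by
      apply hR.hom_ext
      · rw [key, key, reassoc_of% h']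
      · simpa using h
    simpa using this =≫ e₁

end fibre

end DGroupoid

/-! ### Uniqueness and the theorem -/

/-- Two universal activations are related by a unique isomorphism. -/
theorem DGroupoid.Activation.IsUniversal.existsUnique_iso {C : Type u} [Category.{v} C]
    [HasBinaryProducts C] {D : Diptych C} {H G : DGroupoid D} {f : H ⟶ G} {A A' : Activation f}
    (hA : A.IsUniversal) (hA' : A'.IsUniversal) :
    ∃! e : A.mid ≅ A'.mid, A.into ≫ e.hom = A'.into ∧ e.hom ≫ A'.out = A.out := by
  obtain ⟨k, ⟨hk, hk'⟩, hu⟩ := hA A'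
  obtain ⟨l, ⟨hl, hl'⟩, -⟩ := hA' A
  refine ⟨⟨k, l, ?_, ?_⟩, ⟨hk, hk'⟩, fun e he => Iso.ext (hu _ he)⟩
  · exact (hA A).unique ⟨by rw [reassoc_of% hk, hl], by rw [Category.assoc, hl', hk']⟩
      ⟨Category.comp_id _, Category.id_comp _⟩
  · exact (hA' A').unique ⟨by rw [reassoc_of% hl, hk], by rw [Category.assoc, hk', hl']⟩
      ⟨Category.comp_id _, Category.id_comp _⟩

theorem mainTheorem1 {C : Type u} [Category.{v} C] [HasBinaryProducts C] (D : Diptych C)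
    (hD : D.IsGodement) (H G : DGroupoid D) (hH : D.IsSBasic H.base) (hG : D.IsSBasic G.base)
    (f : H ⟶ G) (hf : DGroupoid.IsIFaithful f) :
    (∃ A : DGroupoid.Activation f, A.IsUniversal) ∧
    ∀ A : DGroupoid.Activation f, A.IsUniversal →
      (∀ A' : DGroupoid.Activation f, A'.IsUniversal →
        ∃! e : A.mid ≅ A'.mid, A.into ≫ e.hom = A'.into ∧ e.hom ≫ A'.out = A.out) ∧
      DGroupoid.IsEquivalence A.into ∧
      (DGroupoid.IsHypoActor f ↔ DGroupoid.IsIEquivalence A.into) ∧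
      (DGroupoid.IsHyperActor f ↔ DGroupoid.IsSEquivalence A.into) := by
  obtain ⟨P, g, x, hP, -, -⟩ := D.exists_isPullback G.src G.src_mem f.onBase
  obtain ⟨B, hB⟩ := DGroupoid.exists_isQuotient hP hD hH hf
  refine ⟨⟨B, hB.isUniversal⟩, fun A hA => ?_⟩
  obtain ⟨e, ⟨he, he'⟩, -⟩ := hB.isUniversal.existsUnique_iso hA
  -- The quotient property is transported from the constructed activation to an arbitrary universal
  -- one.
  have hAq : A.IsQuotient hP := hB.of_iso A e he he'
  exact ⟨fun A' hA' => hA.existsUnique_iso hA', hAq.isEquivalence hf, hAq.isHypoActor_iff hf,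
    hAq.isHyperActor_iff hf⟩
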